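/- Let $m,l\ge 0$ be integers, let $g_0,\dots,g_l\in\mathbb{R}^{m\times m}$, and let $G$ be the square FIR (finite impulse response) system with transfer function $$G(z)=\sum_{k=0}^{l} g_k z^{-k},$$ where $\det G(z)\neq 0$ for all $z\in\mathbb{C}$ with $|z|=1$. Put $\|G\|_\infty=\sup_{|z|=1}\|G(z)\|$, where $\|G(z)\|$ is the largest singular value of $G(z)$. A trajectory of $G$ with zero initial condition is a pair of sequences $u_k,y_k\in\mathbb{R}^m$ such that $x_{k+1}=Ax_k+Bu_k$, $y_k=Cx_k+Du_k$, $x_0=0$, for a minimal realization $(A,B,C,D)$ of $G$. For a symmetric $P\in\mathbb{R}^{2m\times 2m}$ and an integer $L\ge 1$, the system $G$ is called $L$-dissipative with respect to $P$ if $$\sum_{k=0}^{h}\begin{pmatrix}u_k\\y_k\end{pmatrix}^{\top}P\begin{pmatrix}u_k\\y_k\end{pmatrix}\ge 0$$ for all $h=0,\dots,L-1$ and all trajectories $(u_k,y_k)_{k=0}^{L-1}$ of $G$ with zero initial condition. It is called dissipative over the infinite horizon with respect to $P$ if the same inequality holds for all $h\ge 0$ and all trajectories $(u_k,y_k)_{k=0}^{\infty}$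 of $G$ with zero initial condition and $\sum_{k=0}^\infty u_k^\top u_k<\infty$. Let $L\ge 1$ be an integer with $L\ge 20\,l$ and let $\gamma\ge 0$. If $G$ is $L$-dissipative with respect to $\begin{pmatrix}\gamma^2 I_m&0\\0&-I_m\end{pmatrix}$, then there is an $\varepsilon$ with $$0\le\varepsilon\le\frac{20\,l}{L}\,\|G\|_\infty$$ such that $G$ is dissipative over the infinite horizon with respect to $\begin{pmatrix}(\gamma+\varepsilon)^2 I_m&0\\0&-I_m\end{pmatrix}$. -/

import Mathlib

/-- A discrete-time state-space model `x⁺ = A x + B u`, `y = C x + D u` of order `n`,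
with `m` inputs and `p` outputs. -/
structure StateSpace (n m p : ℕ) where
  A : Matrix (Fin n) (Fin n) ℝ
  B : Matrix (Fin n) (Fin m) ℝ
  C : Matrix (Fin p) (Fin n) ℝ
  D : Matrix (Fin p) (Fin m) ℝ

namespace StateSpace

variable {n m p : ℕ}

/-- The impulse response `D, C B, C A B, C A² B, …`. -/
def impulseResponse (S : StateSpace n m p) : ℕ → Matrix (Fin p) (Fin m) ℝ
  | 0 => S.D
  | k + 1 => S.C * S.A ^ k * S.B

/-- `S` realizes the LTI system with impulse response `g`. -/
def Realizes (S : StateSpace n m p) (g : ℕ → Matrix (Fin p) (Fin m) ℝ) : Prop :=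
  ∀ k, S.impulseResponse k = g k

/-- `S` is a realization of `g` of least possible order. -/
def IsMinimalRealization (S : StateSpace n m p) (g : ℕ → Matrix (Fin p) (Fin m) ℝ) : Prop :=
  S.Realizes g ∧ ∀ (n' : ℕ) (S' : StateSpace n' m p), S'.Realizes g → n ≤ n'

/-- `(u_k, y_k)`, `k < N`, is a trajectory of `S` with initial state `x₀`; `N = ⊤` is the infinite
horizon. Only the entries with index below `N` are constrained. -/
def IsTrajectory (S : StateSpace n m p) (N : ℕ∞) (x₀ : Fin n → ℝ)
    (u : ℕ → Fin m → ℝ) (y : ℕ → Fin p → ℝ) : Prop :=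
  ∃ x : ℕ → Fin n → ℝ, x 0 = x₀ ∧ ∀ k : ℕ, (k : ℕ∞) < N →
    x (k + 1) = S.A.mulVec (x k) + S.B.mulVec (u k) ∧
      y k = S.C.mulVec (x k) + S.D.mulVec (u k)

end StateSpace

/-- `∑_{k=0}^{h} w_kᵀ P w_k` with the stacked signal `w_k = (u_k, y_k)`. -/
def supplySum {m p : ℕ} (P : Matrix (Fin m ⊕ Fin p) (Fin m ⊕ Fin p) ℝ)
    (u : ℕ → Fin m → ℝ) (y : ℕ → Fin p → ℝ) (h : ℕ) : ℝ :=
  ∑ k ∈ Finset.range (h + 1),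
    dotProduct (Sum.elim (u k) (y k)) (P.mulVec (Sum.elim (u k) (y k)))

/-- `L`-dissipativity with respect to `P` of the LTI system with impulse response `g`. -/
def IsLDissipative {m p : ℕ} (g : ℕ → Matrix (Fin p) (Fin m) ℝ) (L : ℕ)
    (P : Matrix (Fin m ⊕ Fin p) (Fin m ⊕ Fin p) ℝ) : Prop :=
  ∀ (n : ℕ) (S : StateSpace n m p), S.IsMinimalRealization g →
    ∀ (u : ℕ → Fin m → ℝ) (y : ℕ → Fin p → ℝ), S.IsTrajectory (L : ℕ∞) 0 u y →
      ∀ h < L, 0 ≤ supplySum P u y h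

/-- Infinite-horizon dissipativity with respect to `P` of the LTI system with impulse
response `g`: all horizons, all square-summable inputs. -/
def IsDissipative {m p : ℕ} (g : ℕ → Matrix (Fin p) (Fin m) ℝ)
    (P : Matrix (Fin m ⊕ Fin p) (Fin m ⊕ Fin p) ℝ) : Prop :=
  ∀ (n : ℕ) (S : StateSpace n m p), S.IsMinimalRealization g →
    ∀ (u : ℕ → Fin m → ℝ) (y : ℕ → Fin p → ℝ), S.IsTrajectory ⊤ 0 u y →
      Summable (fun k => dotProduct (u k) (u k)) →
        ∀ h : ℕ, 0 ≤ supplySum P u y h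

/-- The supply matrix `diag(γ² I, -I)`. -/
def gainSupply (m : ℕ) (γ : ℝ) : Matrix (Fin m ⊕ Fin m) (Fin m ⊕ Fin m) ℝ :=
  Matrix.fromBlocks (γ ^ 2 • 1) 0 0 (-1)

/-- The transfer function `∑_{k=0}^{l} g_k z^{-k}`. -/
noncomputable def firTransfer {m : ℕ} (l : ℕ) (g : ℕ → Matrix (Fin m) (Fin m) ℝ) (z : ℂ) :
    Matrix (Fin m) (Fin m) ℂ :=
  ∑ k ∈ Finset.range (l + 1), (z⁻¹ ^ k) • (g k).map (fun a : ℝ => (a : ℂ))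

/-- The norm `sup_{|z| = 1} ‖G(z)‖`, where `‖G(z)‖` is the spectral norm (the largest singular
value), for `G` continuous on the unit circle. -/
noncomputable def hInfNorm {m : ℕ} (G : ℂ → Matrix (Fin m) (Fin m) ℂ) : ℝ :=
  ⨆ z : Circle, ‖Matrix.toEuclideanCLM (n := Fin m) (𝕜 := ℂ) (G (z : ℂ))‖

open Finset

/-! From rest the output is `causalConv g u`, and two bounds on its energy are compared. Write x = l
/ L. Slide a window of length L along the signal. After its first l samples, the response inside the
window depends only on inputs inside it, so the L-step gain γ applies. Summing over all positions
counts each output at least L - l times and each input at most L times, which gives (1 - x) ∑|y|² ≤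
γ² ∑|u|². Parseval gives the second bound ∑|y|² ≤ H² ∑|u|², where H is the H∞ norm. Since x ≤ 1/20,
the first bound yields gain at most γ(1 + x), which is within γ + 20xH if γ ≤ 20H. Otherwise H ≤ γ
and the second bound suffices. Hence ε = 20xH works. -/

/-- The causal convolution `∑_{i ≤ k} g_i u_{k-i}`, i.e. the output with zero initial state. -/
def causalConv {m p : ℕ} (g : ℕ → Matrix (Fin p) (Fin m) ℝ) (u : ℕ → Fin m → ℝ) (k : ℕ) :
    Fin p → ℝ :=
  ∑ i ∈ range (k + 1), (g i).mulVec (u (k - i))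

/-! ### Trajectories from rest as convolutions -/

theorem StateSpace.output_eq_causalConv {n m p : ℕ} (S : StateSpace n m p)
    (u : ℕ → Fin m → ℝ) (x : ℕ → Fin n → ℝ) (h0 : x 0 = 0) (N : ℕ)
    (hx : ∀ k < N, x (k + 1) = S.A.mulVec (x k) + S.B.mulVec (u k)) (k : ℕ) (hk : k ≤ N) :
    S.C.mulVec (x k) + S.D.mulVec (u k) = causalConv S.impulseResponse u k := by
  have key : ∀ k ≤ N, x k = ∑ i ∈ range k, (S.A ^ i * S.B).mulVec (u (k - (i + 1))) := by
    intro k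
    induction k with
    | zero => intro _; simp [h0]
    | succ k ih =>
      intro hk
      rw [hx k (by omega), ih (by omega), sum_range_succ', Matrix.mulVec_sum]
      congr 1
      · refine sum_congr rfl fun i _ => ?_
        rw [Matrix.mulVec_mulVec, ← Matrix.mul_assoc, ← pow_succ']
        congr 2
        omega
      · simp
  rw [causalConv, sum_range_succ', key k hk, Matrix.mulVec_sum]
  congr 1
  refine sum_congr rfl fun i _ => ?_
  rw [Matrix.mulVec_mulVec, ← Matrix.mul_assoc]
  rfl

theorem StateSpace.IsTrajectory.eq_causalConv {n m p : ℕ} {S : StateSpace n m p}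
    {g : ℕ → Matrix (Fin p) (Fin m) ℝ} (hS : S.Realizes g)
    {u : ℕ → Fin m → ℝ} {y : ℕ → Fin p → ℝ} (h : S.IsTrajectory ⊤ 0 u y) (k : ℕ) :
    y k = causalConv g u k := by
  obtain ⟨x, h0, hx⟩ := h
  have hg : S.impulseResponse = g := funext hS
  rw [(hx k (ENat.natCast_lt_top k)).2, ← hg]
  exact S.output_eq_causalConv u x h0 k (fun j _ => (hx j (ENat.natCast_lt_top j)).1) k le_rfl

theorem StateSpace.isTrajectory_causalConv {n m p : ℕ} {S : StateSpace n m p}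
    {g : ℕ → Matrix (Fin p) (Fin m) ℝ} (hS : S.Realizes g) (N : ℕ∞) (u : ℕ → Fin m → ℝ) :
    S.IsTrajectory N 0 u (causalConv g u) := by
  have hg : S.impulseResponse = g := funext hS
  let x : ℕ → Fin n → ℝ := fun k =>
    Nat.rec 0 (fun k xk => S.A.mulVec xk + S.B.mulVec (u k)) k
  refine ⟨x, rfl, fun k _ => ⟨rfl, ?_⟩⟩
  rw [← hg]
  exact (S.output_eq_causalConv u x rfl k (fun _ _ => rfl) k le_rfl).symm

theorem supplySum_gainSupply {m : ℕ} (γ : ℝ) (u y : ℕ → Fin m → ℝ) (h : ℕ) :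
    supplySum (gainSupply m γ) u y h =
      γ ^ 2 * ∑ k ∈ range (h + 1), dotProduct (u k) (u k) -
        ∑ k ∈ range (h + 1), dotProduct (y k) (y k) := by
  rw [supplySum, mul_sum, ← sum_sub_distrib]
  refine sum_congr rfl fun k _ => ?_
  rw [gainSupply, Matrix.fromBlocks_mulVec]
  simp [Matrix.smul_mulVec, Matrix.neg_mulVec, sub_eq_add_neg]

theorem dotProduct_self_nonneg_real {m : ℕ} (v : Fin m → ℝ) : 0 ≤ dotProduct v v :=
  sum_nonneg fun _ _ => mul_self_nonneg _

/-! ### Averaging over windows -/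

theorem causalConv_eq_sum_range {m p : ℕ} {g : ℕ → Matrix (Fin p) (Fin m) ℝ} {l : ℕ}
    (hg : ∀ k, l < k → g k = 0) (u : ℕ → Fin m → ℝ) (k : ℕ) :
    causalConv g u k =
      ∑ i ∈ range (l + 1), if i ≤ k then (g i).mulVec (u (k - i)) else 0 := by
  rw [← sum_filter, causalConv]
  symm
  refine sum_subset (fun i hi => ?_) (fun i hi hi' => ?_)
  · simp only [mem_filter, mem_range] at hi ⊢
    omega
  · simp only [mem_filter, mem_range] at hi hi'
    rw [hg i (by omega), Matrix.zero_mulVec]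

/-- Averaging a gain bound on windows of length `L` over all positions of the window. -/
theorem sum_causalConv_le_of_window {m p : ℕ} {g : ℕ → Matrix (Fin p) (Fin m) ℝ} {l L : ℕ}
    (hg : ∀ k, l < k → g k = 0) (hl : l ≤ L) {c : ℝ} (hc : 0 ≤ c)
    (hw : ∀ v : ℕ → Fin m → ℝ, ∑ k ∈ range L, dotProduct (causalConv g v k) (causalConv g v k) ≤
      c * ∑ k ∈ range L, dotProduct (v k) (v k)) (u : ℕ → Fin m → ℝ) (h : ℕ) :
    ((L : ℝ) - l) * ∑ k ∈ range (h + 1), dotProduct (causalConv g u k) (causalConv g u k) ≤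
      c * (L * ∑ k ∈ range (h + 1), dotProduct (u k) (u k)) := by
  -- Delaying the input by L lets windows overhang its start while their positions stay natural
  -- numbers.
  set U : ℕ → Fin m → ℝ := fun n => if L ≤ n ∧ n ≤ L + h then u (n - L) else 0 with hU
  set Y : ℕ → Fin p → ℝ := causalConv g U with hY
  have hYu : ∀ k ≤ h, Y (L + k) = causalConv g u k := by
    intro k hk
    rw [hY, causalConv_eq_sum_range hg, causalConv_eq_sum_range hg]
    refine sum_congr rfl fun i hi => ?_
    have hi' : i ≤ l := by simpa [Nat.lt_succ_iff] using hi
    rw [if_pos (by omega)]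
    split_ifs with hik
    · simp only [hU]
      rw [if_pos (by omega)]
      congr 2
      omega
    · simp only [hU]
      rw [if_neg (by omega), Matrix.mulVec_zero]
  -- Offsets t < l are dropped: there the output may depend on inputs before the window.
  have hwin : ∀ a, ∑ t ∈ Ico l L, dotProduct (Y (a + t)) (Y (a + t)) ≤
      c * ∑ t ∈ range L, dotProduct (U (a + t)) (U (a + t)) := by
    intro a
    refine le_trans ?_ (hw fun k => U (a + k))
    have : ∀ t ∈ Ico l L, dotProduct (Y (a + t)) (Y (a + t)) =
        dotProduct (causalConv g (fun k => U (a + k)) t)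
          (causalConv g (fun k => U (a + k)) t) := by
      intro t ht
      have ht' := mem_Ico.1 ht
      have : Y (a + t) = causalConv g (fun k => U (a + k)) t := by
        rw [hY, causalConv_eq_sum_range hg, causalConv_eq_sum_range hg]
        refine sum_congr rfl fun i hi => ?_
        have hi' : i ≤ l := by simpa [Nat.lt_succ_iff] using hi
        rw [if_pos (by omega), if_pos (by omega)]
        congr 2
        omega
      rw [this]
    rw [sum_congr rfl this]
    refine sum_le_sum_of_subset_of_nonneg (fun t ht => ?_)
      fun _ _ _ => dotProduct_self_nonneg_real _
    exact mem_range.2 (mem_Ico.1 ht).2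
  have hsum := sum_le_sum fun a (_ : a ∈ range (L + h + 1)) => hwin a
  rw [← mul_sum, sum_comm, sum_comm (s := range (L + h + 1)) (t := range L)] at hsum
  -- For each of the L - l offsets t, the window starting at L - t + k sees output k.
  have hlow : ((L : ℝ) - l) *
      ∑ k ∈ range (h + 1), dotProduct (causalConv g u k) (causalConv g u k) ≤
      ∑ t ∈ Ico l L, ∑ a ∈ range (L + h + 1), dotProduct (Y (a + t)) (Y (a + t)) := by
    rw [← Nat.cast_sub hl, ← Nat.card_Ico, ← nsmul_eq_mul]
    refine card_nsmul_le_sum _ _ _ fun t ht => ?_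
    have ht' := mem_Ico.1 ht
    have e : ∀ k ∈ range (h + 1), dotProduct (causalConv g u k) (causalConv g u k) =
        dotProduct (Y (L - t + k + t)) (Y (L - t + k + t)) := by
      intro k hk
      rw [show L - t + k + t = L + k by omega, hYu k (by simpa [Nat.lt_succ_iff] using hk)]
    rw [sum_congr rfl e]
    rw [← sum_image (s := range (h + 1)) (g := fun k => L - t + k)
      (f := fun a => dotProduct (Y (a + t)) (Y (a + t))) (by intro a _ b _ hab; simpa using hab)]
    refine sum_le_sum_of_subset_of_nonneg (fun a ha => ?_)
      fun _ _ _ => dotProduct_self_nonneg_real _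
    simp only [mem_image, mem_range] at ha ⊢
    omega
  have hup : ∑ t ∈ range L, ∑ a ∈ range (L + h + 1), dotProduct (U (a + t)) (U (a + t)) ≤
      L * ∑ k ∈ range (h + 1), dotProduct (u k) (u k) := by
    rw [← nsmul_eq_mul]
    conv_rhs => rw [← card_range L]
    refine sum_le_card_nsmul _ _ _ fun t _ => ?_
    have e : ∀ k ∈ range (h + 1), dotProduct (u k) (u k) =
        dotProduct (U (L + k)) (U (L + k)) := by
      intro k hk
      have := mem_range.1 hk
      simp only [hU]
      rw [if_pos (by omega), Nat.add_sub_cancel_left]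
    rw [sum_congr rfl e, ← sum_image (s := range (L + h + 1)) (g := fun k => k + t)
      (f := fun a => dotProduct (U a) (U a)) (by intro a _ b _ hab; simpa using hab),
      ← sum_image (s := range (h + 1)) (g := fun k => L + k)
      (f := fun a => dotProduct (U a) (U a)) (by intro a _ b _ hab; simpa using hab)]
    have hz : ∀ n, n ∉ image (fun k => L + k) (range (h + 1)) → U n = 0 := by
      intro n hn
      simp only [hU]
      refine if_neg fun hn' => hn ?_
      exact mem_image.2 ⟨n - L, mem_range.2 (by omega), by omega⟩
    rw [← sum_filter_ne_zero]
    refine sum_le_sum_of_subset_of_nonneg (fun n hn => ?_)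
      fun _ _ _ => dotProduct_self_nonneg_real _
    by_contra hn'
    exact (mem_filter.1 hn).2 (by rw [hz n hn', zero_dotProduct])
  calc _ ≤ _ := hlow
    _ ≤ _ := hsum
    _ ≤ _ := mul_le_mul_of_nonneg_left hup hc

/-! ### Parseval and the H∞ bound -/

/-- Parseval's identity for the discrete Fourier transform of a finite real sequence. -/
theorem IsPrimitiveRoot.sum_norm_sq_dft {M : ℕ} {ζ : ℂ} (hζ : IsPrimitiveRoot ζ M)
    (hM : M ≠ 0) (f : ℕ → ℝ) :
    ∑ j ∈ range M, ‖∑ n ∈ range M, (ζ ^ j) ^ n * (f n : ℂ)‖ ^ 2 =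
      M * ∑ n ∈ range M, f n * f n := by
  have hnorm : ‖ζ‖ = 1 := hζ.norm'_eq_one hM
  have hconj : ζ * (starRingEnd ℂ) ζ = 1 := by
    rw [Complex.mul_conj, Complex.normSq_eq_norm_sq, hnorm]
    simp
  -- Orthogonality of the characters of ℤ/M, by a geometric sum.
  have orth : ∀ n ∈ range M, ∀ k ∈ range M,
      ∑ j ∈ range M, (ζ ^ n * (starRingEnd ℂ) ζ ^ k) ^ j = if n = k then (M : ℂ) else 0 := by
    intro n hn k hk
    split_ifs with hnk
    · subst hnk
      simp [← mul_pow, hconj]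
    · have hne : ζ ^ n * (starRingEnd ℂ) ζ ^ k ≠ 1 := by
        intro h1
        apply hnk
        apply hζ.pow_inj (mem_range.1 hn) (mem_range.1 hk)
        calc ζ ^ n = ζ ^ n * (ζ * (starRingEnd ℂ) ζ) ^ k := by rw [hconj]; simp
          _ = (ζ ^ n * (starRingEnd ℂ) ζ ^ k) * ζ ^ k := by ring
          _ = ζ ^ k := by rw [h1, one_mul]
      rw [geom_sum_eq hne]
      have : (ζ ^ n * (starRingEnd ℂ) ζ ^ k) ^ M = 1 := by
        rw [mul_pow, ← pow_mul, ← pow_mul, mul_comm n, mul_comm k, pow_mul, pow_mul,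
          ← map_pow, hζ.pow_eq_one]
        simp
      rw [this]
      simp
  have main : (∑ j ∈ range M, (∑ n ∈ range M, (ζ ^ j) ^ n * (f n : ℂ)) *
      (starRingEnd ℂ) (∑ n ∈ range M, (ζ ^ j) ^ n * (f n : ℂ))) =
      M * ∑ n ∈ range M, (f n : ℂ) * f n := by
    simp only [map_sum, map_mul, map_pow, Complex.conj_ofReal, sum_mul_sum]
    rw [sum_comm, mul_sum]
    refine sum_congr rfl fun n hn => ?_
    rw [sum_comm]
    calc _ = ∑ k ∈ range M, (if n = k then (M : ℂ) else 0) * (f n * f k) := by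
          refine sum_congr rfl fun k hk => ?_
          rw [← orth n hn k hk, sum_mul]
          refine sum_congr rfl fun j _ => ?_
          rw [mul_pow, ← pow_mul, ← pow_mul, ← pow_mul, ← pow_mul, mul_comm j, mul_comm j]
          ring
      _ = _ := by
          simp only [ite_mul, zero_mul, sum_ite_eq, if_pos hn]
  have : ((∑ j ∈ range M, ‖∑ n ∈ range M, (ζ ^ j) ^ n * (f n : ℂ)‖ ^ 2 : ℝ) : ℂ) =
      ((M * ∑ n ∈ range M, f n * f n : ℝ) : ℂ) := by
    push_cast
    rw [← main]
    exact sum_congr rfl fun j _ => (Complex.mul_conj' _).symm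
  exact_mod_cast this

theorem norm_firTransfer_le_hInfNorm {m : ℕ} (l : ℕ) (g : ℕ → Matrix (Fin m) (Fin m) ℝ)
    (z : Circle) :
    ‖Matrix.toEuclideanCLM (n := Fin m) (𝕜 := ℂ) (firTransfer l g z)‖ ≤
      hInfNorm (firTransfer l g) := by
  -- Continuity on the compact circle bounds the family; an unbounded real supremum would default to
  -- 0.
  have hcont : Continuous fun z : Circle =>
      ‖Matrix.toEuclideanCLM (n := Fin m) (𝕜 := ℂ) (firTransfer l g z)‖ := by
    simp only [firTransfer, map_sum, map_smul]
    refine Continuous.norm (continuous_finsetSum _ fun k _ => ?_)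
    have hinv : Continuous fun z : Circle => (z : ℂ)⁻¹ := by
      simp only [← Circle.coe_inv]
      exact continuous_subtype_val.comp continuous_inv
    exact (hinv.pow k).smul continuous_const
  exact le_ciSup (isCompact_range hcont).bddAbove z

theorem sum_norm_sq_mulVec_le {m : ℕ} (A : Matrix (Fin m) (Fin m) ℂ) (v : Fin m → ℂ) :
    ∑ r, ‖A.mulVec v r‖ ^ 2 ≤
      ‖Matrix.toEuclideanCLM (n := Fin m) (𝕜 := ℂ) A‖ ^ 2 * ∑ r, ‖v r‖ ^ 2 := by
  have h := (Matrix.toEuclideanCLM (n := Fin m) (𝕜 := ℂ) A).le_opNorm (WithLp.toLp 2 v)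
  have h2 := pow_le_pow_left₀ (norm_nonneg _) h 2
  rw [mul_pow, EuclideanSpace.norm_sq_eq, EuclideanSpace.norm_sq_eq] at h2
  simpa using h2

/-- Convolution becomes a product of polynomials in z. Input supported up to h gives output
supported up to h + l, so truncating at h + l + 1 loses nothing. -/
theorem firTransfer_mulVec_sum {m l h : ℕ} {g : ℕ → Matrix (Fin m) (Fin m) ℝ}
    (hg : ∀ k, l < k → g k = 0) {u : ℕ → Fin m → ℝ} (hu : ∀ k, h < k → u k = 0) (z : ℂ)
    (r : Fin m) :
    (firTransfer l g z⁻¹).mulVec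
        (fun s => ∑ n ∈ range (h + l + 1), z ^ n * ((u n s : ℝ) : ℂ)) r =
      ∑ n ∈ range (h + l + 1), z ^ n * ((causalConv g u n r : ℝ) : ℂ) := by
  have e : ∀ i ∈ range (l + 1), ∀ s, ∑ n ∈ range (h + l + 1),
      z ^ n * (if i ≤ n then ((u (n - i) s : ℝ) : ℂ) else 0) =
      z ^ i * ∑ n ∈ range (h + l + 1), z ^ n * ((u n s : ℝ) : ℂ) := by
    intro i hi s
    have hi' := mem_range.1 hi
    have trunc : ∀ N, h + 1 ≤ N → ∑ n ∈ range N, z ^ n * ((u n s : ℝ) : ℂ) =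
        ∑ n ∈ range (h + 1), z ^ n * ((u n s : ℝ) : ℂ) := by
      intro N hN
      symm
      refine sum_subset (range_subset_range.2 hN) fun n _ hn => ?_
      rw [hu n (by simpa using hn)]
      simp
    rw [trunc (h + l + 1) (by omega), ← trunc (h + l + 1 - i) (by omega),
      show h + l + 1 = i + (h + l + 1 - i) by omega, sum_range_add, Nat.add_sub_cancel_left,
      sum_eq_zero, zero_add, mul_sum]
    · refine sum_congr rfl fun n _ => ?_
      rw [if_pos (by omega), Nat.add_sub_cancel_left, pow_add]
      ring
    · intro n hn
      have := mem_range.1 hn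
      rw [if_neg (by omega), mul_zero]
  have hconv : ∀ n, ((causalConv g u n r : ℝ) : ℂ) =
      ∑ i ∈ range (l + 1), ∑ s, (g i r s : ℂ) * (if i ≤ n then ((u (n - i) s : ℝ) : ℂ) else 0) := by
    intro n
    rw [causalConv_eq_sum_range hg, Finset.sum_apply]
    push_cast
    refine sum_congr rfl fun i _ => ?_
    split_ifs
    · simp [Matrix.mulVec, dotProduct]
    · simp
  simp only [hconv, mul_sum]
  rw [sum_comm]
  rw [firTransfer, Matrix.sum_mulVec, Finset.sum_apply]
  refine sum_congr rfl fun i hi => ?_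
  rw [sum_comm]
  rw [inv_inv, Matrix.smul_mulVec, Pi.smul_apply, smul_eq_mul]
  simp only [Matrix.mulVec, dotProduct, Matrix.map_apply]
  rw [mul_sum]
  refine sum_congr rfl fun s _ => ?_
  rw [mul_left_comm, ← e i hi s, mul_sum]
  exact sum_congr rfl fun n _ => mul_left_comm _ _ _

/-- The gain over every finite horizon is at most the `H∞` norm. -/
theorem sum_causalConv_le_hInfNorm {m l : ℕ} {g : ℕ → Matrix (Fin m) (Fin m) ℝ}
    (hg : ∀ k, l < k → g k = 0) (u : ℕ → Fin m → ℝ) (h : ℕ) :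
    ∑ k ∈ range (h + 1), dotProduct (causalConv g u k) (causalConv g u k) ≤
      hInfNorm (firTransfer l g) ^ 2 * ∑ k ∈ range (h + 1), dotProduct (u k) (u k) := by
  -- By causality, cutting the input after h leaves outputs 0, …, h unchanged.
  set v : ℕ → Fin m → ℝ := fun k => if k ≤ h then u k else 0 with hv
  have hv0 : ∀ k, h < k → v k = 0 := fun k hk => if_neg (by omega)
  set M := h + l + 1 with hM
  have hM0 : M ≠ 0 := by omega
  have hζ := Complex.isPrimitiveRoot_exp M hM0
  set ζ := Complex.exp (2 * Real.pi * Complex.I / M)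
  have parseval : ∀ w : ℕ → Fin m → ℝ,
      ∑ j ∈ range M, ∑ r, ‖∑ n ∈ range M, (ζ ^ j) ^ n * ((w n r : ℝ) : ℂ)‖ ^ 2 =
        M * ∑ n ∈ range M, dotProduct (w n) (w n) := by
    intro w
    rw [sum_comm]
    simp only [dotProduct]
    rw [sum_comm (s := range M), mul_sum]
    exact sum_congr rfl fun r _ => hζ.sum_norm_sq_dft hM0 fun n => w n r
  have hfreq : (M : ℝ) * ∑ n ∈ range M, dotProduct (causalConv g v n) (causalConv g v n) ≤
      M * (hInfNorm (firTransfer l g) ^ 2 * ∑ n ∈ range M, dotProduct (v n) (v n)) := by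
    rw [mul_left_comm, ← parseval, ← parseval, mul_sum]
    refine sum_le_sum fun j _ => ?_
    have hz : ‖(ζ ^ j)⁻¹‖ = 1 := by
      rw [norm_inv, norm_pow, hζ.norm'_eq_one hM0]
      simp
    have hb := norm_firTransfer_le_hInfNorm l g
      (⟨(ζ ^ j)⁻¹, mem_sphere_zero_iff_norm.2 hz⟩ : Circle)
    calc _ = ∑ r, ‖(firTransfer l g (ζ ^ j)⁻¹).mulVec
          (fun s => ∑ n ∈ range M, (ζ ^ j) ^ n * ((v n s : ℝ) : ℂ)) r‖ ^ 2 := by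
          refine sum_congr rfl fun r _ => ?_
          rw [firTransfer_mulVec_sum hg hv0]
      _ ≤ _ := sum_norm_sq_mulVec_le _ _
      _ ≤ _ := mul_le_mul_of_nonneg_right (pow_le_pow_left₀ (norm_nonneg _) hb 2)
          (sum_nonneg fun _ _ => sq_nonneg _)
  have hfreq' := le_of_mul_le_mul_left hfreq (by positivity)
  have hsub : range (h + 1) ⊆ range M := range_subset_range.2 (by omega)
  calc _ = ∑ k ∈ range (h + 1), dotProduct (causalConv g v k) (causalConv g v k) := by
        refine sum_congr rfl fun k hk => ?_
        have hk' := mem_range.1 hk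
        have : causalConv g v k = causalConv g u k :=
          sum_congr rfl fun i _ => by simp only [hv]; rw [if_pos (by omega)]
        rw [this]
    _ ≤ ∑ k ∈ range M, dotProduct (causalConv g v k) (causalConv g v k) :=
        sum_le_sum_of_subset_of_nonneg hsub fun _ _ _ => dotProduct_self_nonneg_real _
    _ ≤ _ := hfreq'
    _ = _ := by
        congr 1
        rw [← sum_subset hsub fun k _ hk => by
          rw [hv0 k (by simpa using hk), zero_dotProduct]]
        refine sum_congr rfl fun k hk => ?_
        have hk' := mem_range.1 hk
        simp only [hv]
        rw [if_pos (by omega)]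

/-! ### Combining the two bounds -/

theorem hInfNorm_nonneg {m : ℕ} (G : ℂ → Matrix (Fin m) (Fin m) ℂ) : 0 ≤ hInfNorm G :=
  Real.iSup_nonneg fun _ => norm_nonneg _

/-- A gain bound `√(L / (L - l)) γ`, combined with the bound `H`, is at most `γ + (20 l / L) H`. -/
theorem le_gain_of_window_bounds {x γ H Y U : ℝ} (hx0 : 0 ≤ x) (hx1 : x ≤ 1 / 20) (hγ : 0 ≤ γ)
    (hH : 0 ≤ H) (hU : 0 ≤ U) (h1 : (1 - x) * Y ≤ γ ^ 2 * U) (h2 : Y ≤ H ^ 2 * U) :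
    Y ≤ (γ + 20 * x * H) ^ 2 * U := by
  rcases le_total γ (20 * H) with hc | hc
  · have h3 : Y ≤ (γ * (1 + x)) ^ 2 * U := by
      -- The product equals 1 + x - x² - x³.
      have hk : 1 ≤ (1 + x) ^ 2 * (1 - x) := by nlinarith [mul_nonneg hx0 hx0]
      have hp : (1 - x) * Y ≤ (1 - x) * ((γ * (1 + x)) ^ 2 * U) := by
        calc (1 - x) * Y ≤ 1 * (γ ^ 2 * U) := by rw [one_mul]; exact h1
          _ ≤ ((1 + x) ^ 2 * (1 - x)) * (γ ^ 2 * U) :=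
            mul_le_mul_of_nonneg_right hk (by positivity)
          _ = _ := by ring
      exact le_of_mul_le_mul_left hp (by linarith)
    refine h3.trans (mul_le_mul_of_nonneg_right (pow_le_pow_left₀ (by positivity) ?_ 2) hU)
    nlinarith [mul_le_mul_of_nonneg_left hc hx0]
  · refine h2.trans (mul_le_mul_of_nonneg_right (pow_le_pow_left₀ hH ?_ 2) hU)
    have : 0 ≤ 20 * x * H := by positivity
    linarith

theorem mainTheorem4 (m l : ℕ) (g : ℕ → Matrix (Fin m) (Fin m) ℝ)
    (hg : ∀ k, l < k → g k = 0)
    (hdet : ∀ z : ℂ, ‖z‖ = 1 → (firTransfer l g z).det ≠ 0)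
    (L : ℕ) (hL : 20 * l ≤ L) (hL1 : 1 ≤ L) (γ : ℝ) (hγ : 0 ≤ γ)
    (hdiss : IsLDissipative g L (gainSupply m γ)) :
    ∃ ε : ℝ, 0 ≤ ε ∧ ε ≤ (20 * (l : ℝ) / (L : ℝ)) * hInfNorm (firTransfer l g) ∧
      IsDissipative g (gainSupply m (γ + ε)) := by

  refine ⟨20 * (l : ℝ) / L * hInfNorm (firTransfer l g),
    mul_nonneg (by positivity) (hInfNorm_nonneg _), le_rfl, ?_⟩
  intro n S hS u y hy _ h
  have hyc : y = causalConv g u := funext fun k => hy.eq_causalConv hS.1 k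
  have hw : ∀ v : ℕ → Fin m → ℝ,
      ∑ k ∈ range L, dotProduct (causalConv g v k) (causalConv g v k) ≤
        γ ^ 2 * ∑ k ∈ range L, dotProduct (v k) (v k) := by
    intro v
    -- Only the longest horizon h = L - 1 is needed.
    have := hdiss n S hS v _ (StateSpace.isTrajectory_causalConv hS.1 L v) (L - 1) (by omega)
    rw [supplySum_gainSupply, Nat.sub_add_cancel hL1] at this
    linarith
  have hLpos : (0 : ℝ) < L := by exact_mod_cast hL1
  have hLl : 20 * (l : ℝ) ≤ L := by exact_mod_cast hL
  have havg := sum_causalConv_le_of_window hg (by omega) (sq_nonneg γ) hw u h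
  have hinf := sum_causalConv_le_hInfNorm hg u h
  rw [supplySum_gainSupply, hyc, sub_nonneg, mul_div_assoc]
  refine le_gain_of_window_bounds (by positivity) ?_ hγ (hInfNorm_nonneg _)
    (sum_nonneg fun _ _ => dotProduct_self_nonneg_real _) ?_ hinf
  · rw [div_le_div_iff₀ hLpos (by norm_num)]
    linarith
  · refine le_of_mul_le_mul_left ?_ hLpos
    have e : (L : ℝ) * (1 - l / L) = L - l := by field_simp
    rw [← mul_assoc, e]
    linarith
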